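/- In real quantum theory let a two-rebit vector be a real symmetric $4\times4$ matrix, regarded as acting on $\mathbb R^2\otimes\mathbb R^2$; write $AB$ for the real vector space of all of these, and let $\Omega_{AB}\subset AB$ be the set of two-rebit states, i.e. of positive semidefinite $\rho\in AB$ with $\operatorname{Tr}\rho=1$. A rebit state is a real symmetric positive semidefinite $2\times2$ matrix of trace $1$, and a rebit effect is a real symmetric $2\times2$ matrix $M$ with $0\le M\le\mathds 1$. Let $AB_\otimes\subset AB$ be the linear span of the products $\alpha\otimes\beta$ of rebit states, and let $H_S\subset AB$ be the subspace of all $h\in AB$ with $\operatorname{Tr}\big((e\otimes f)h\big)=0$ for all rebit effects $e,f$. Then $AB=AB_\otimes\oplus H_S$, and $\Pi_{\rm TL}:AB\to AB$ denotes the linear projection onto $AB_\otimes$ along $H_S$. A two-rebit matrix is separable in real quantum theory if it equals a finite sum $\sum_i p_i\,\alpha_i\otimes\beta_i$ with $p_i\ge0$, $\sum_ip_i=1$ and rebit states $\alpha_i,\beta_i$; separability of a complex $4\times4$ matrix in complex quantum theory is defined in the same way with qubit states (complex positive semidefinite $2\times2$ matrices of trace $1$). A state $\rho\in\Omega_{AB}$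 has TL-entanglement if $\Pi_{\rm TL}(\rho)$ is not separable in real quantum theory; otherwise it lacks TL-entanglement. **Proposition.** Let $\rho\in\Omega_{AB}$ be a two-rebit state. Then: 1. $\rho$ lacks TL-entanglement if and only if $\Pi_{\rm TL}(\rho)\in\Omega_{AB}$, i.e. $\Pi_{\rm TL}(\rho)$ is a valid two-rebit state. 2. Let $\iota(\rho)$ be $\rho$ regarded as a complex matrix, i.e. as a two-qubit state. If $\iota(\rho)$ is separable in complex quantum theory, then $\rho$ lacks TL-entanglement. -/

import Mathlib

open scoped Kronecker ComplexOrder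

noncomputable section

namespace RealQT

/-- Normalized states of the quantum system with levels `n` over the scalars `𝕜`: positive
semidefinite (in particular Hermitian; symmetric when `𝕜 = ℝ`) matrices of unit trace.
`𝕜 = ℝ` is real quantum theory, `𝕜 = ℂ` is complex quantum theory. -/
def states (𝕜 : Type*) [RCLike 𝕜] (n : Type*) [Fintype n] : Set (Matrix n n 𝕜) :=
  {ρ | ρ.PosSemidef ∧ ρ.trace = 1}

/-- Effects: matrices `M` with `0 ≤ M ≤ 1` in the positive semidefinite order; an effect `M` acts
on a state `ρ` by the Born rule `ρ ↦ Tr (M ρ)`. -/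
def effects (𝕜 : Type*) [RCLike 𝕜] (n : Type*) [DecidableEq n] : Set (Matrix n n 𝕜) :=
  {M | M.PosSemidef ∧ (1 - M : Matrix n n 𝕜).PosSemidef}

/-- Separable states of a bipartite system: convex combinations `∑ i, p i • (α i ⊗ β i)` of
products of normalized local states, all taken within the theory over `𝕜`. -/
def separableStates (𝕜 : Type*) [RCLike 𝕜] (m n : Type*) [Fintype m] [Fintype n] :
    Set (Matrix (m × n) (m × n) 𝕜) :=
  {ρ | ∃ (k : ℕ) (p : Fin k → ℝ) (α : Fin k → Matrix m m 𝕜) (β : Fin k → Matrix n n 𝕜),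
    (∀ i, 0 ≤ p i) ∧ ∑ i, p i = 1 ∧ (∀ i, α i ∈ states 𝕜 m) ∧ (∀ i, β i ∈ states 𝕜 n) ∧
    ρ = ∑ i, p i • (α i ⊗ₖ β i)}

/-- The real vector space of the real quantum system with levels `n`: real symmetric matrices. -/
def symSpace (n : Type*) : Submodule ℝ (Matrix n n ℝ) where
  carrier := {M | M.IsSymm}
  add_mem' h₁ h₂ := h₁.add h₂
  zero_mem' := Matrix.isSymm_zero
  smul_mem' c _ h := h.smul c

/-- The tomographically local subspace of the composite: the span of the product states. -/
def tlSubspace (m n : Type*) [Fintype m] [Fintype n] : Submodule ℝ (symSpace (m × n)) :=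
  Submodule.span ℝ
    {v | ∃ α ∈ states ℝ m, ∃ β ∈ states ℝ n, (v : Matrix (m × n) (m × n) ℝ) = α ⊗ₖ β}

/-- The holistic subspace of the composite: vectors on which every product effect vanishes. -/
def holisticSubspace (m n : Type*) [Fintype m] [Fintype n] [DecidableEq m] [DecidableEq n] :
    Submodule ℝ (symSpace (m × n)) where
  carrier := {h | ∀ e ∈ effects ℝ m, ∀ f ∈ effects ℝ n,
    Matrix.trace ((e ⊗ₖ f) * (h : Matrix (m × n) (m × n) ℝ)) = 0}
  add_mem' h₁ h₂ e he f hf := by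
    simp [Matrix.mul_add, h₁ e he f hf, h₂ e he f hf]
  zero_mem' e _ f _ := by simp
  smul_mem' c _ h e he f hf := by
    simp [h e he f hf]

/-- The rebit: the two-level system of real quantum theory. -/
abbrev Rebit : Type := Fin 2

/-- The vector space of a pair of rebits: real symmetric `4 × 4` matrices. -/
abbrev TwoRebitSpace : Type := symSpace (Rebit × Rebit)

/-- Three rebit pure states spanning the symmetric `2 × 2` matrices:
`|0⟩⟨0|`, `|1⟩⟨1|` and `|+⟩⟨+|`. -/
def probe : Fin 3 → Matrix Rebit Rebit ℝ :=
  ![!![1, 0; 0, 0], !![0, 0; 0, 1], !![1 / 2, 1 / 2; 1 / 2, 1 / 2]]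

lemma posSemidef_of_idem {M : Matrix Rebit Rebit ℝ} (h : M.transpose * M = M) :
    M.PosSemidef := by
  rw [← h, ← Matrix.conjTranspose_eq_transpose_of_trivial]
  exact Matrix.posSemidef_conjTranspose_mul_self M

lemma probe_mem_states (i : Fin 3) : probe i ∈ states ℝ Rebit := by
  refine ⟨posSemidef_of_idem ?_, ?_⟩
  · fin_cases i <;> ext a b <;> fin_cases a <;> fin_cases b <;>
      norm_num [probe, Matrix.mul_apply, Fin.sum_univ_two]
  · fin_cases i <;> norm_num [probe, Matrix.trace, Fin.sum_univ_two]

lemma probe_mem_effects (i : Fin 3) : probe i ∈ effects ℝ Rebit := by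
  refine ⟨(probe_mem_states i).1, posSemidef_of_idem ?_⟩
  fin_cases i <;> ext a b <;> fin_cases a <;> fin_cases b <;>
    norm_num [probe, Matrix.mul_apply, Fin.sum_univ_two]

/-- The holistic vectors of two rebits are antisymmetric under transposition of one factor. -/
lemma holistic_apply {h : TwoRebitSpace} (hh : h ∈ holisticSubspace Rebit Rebit)
    (a b c d : Rebit) : h.1 (a, b) (c, d) = - h.1 (a, d) (c, b) := by
  have sy : ∀ x y, h.1 x y = h.1 y x := fun x y => Matrix.IsSymm.apply h.2 y x
  have key : ∀ i j : Fin 3, Matrix.trace ((probe i ⊗ₖ probe j) * h.1) = 0 := fun i j =>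
    hh _ (probe_mem_effects i) _ (probe_mem_effects j)
  have k := fun i j => key i j
  simp only [Matrix.trace, Matrix.diag, Matrix.mul_apply, Fintype.sum_prod_type,
    Fin.sum_univ_two, Matrix.kroneckerMap_apply] at k
  have k00 := k 0 0
  have k01 := k 0 1
  have k02 := k 0 2
  have k10 := k 1 0
  have k11 := k 1 1
  have k12 := k 1 2
  have k20 := k 2 0
  have k21 := k 2 1
  have k22 := k 2 2
  have s1 := sy (0, 0) (0, 1)
  have s2 := sy (0, 0) (1, 0)
  have s3 := sy (0, 0) (1, 1)
  have s4 := sy (0, 1) (1, 0)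
  have s5 := sy (0, 1) (1, 1)
  have s6 := sy (1, 0) (1, 1)
  simp [probe] at k00 k01 k02 k10 k11 k12 k20 k21 k22
  fin_cases a <;> fin_cases b <;> fin_cases c <;> fin_cases d <;> simp <;> linarith

/-- The tomographically local vectors are symmetric under transposition of one factor. -/
lemma tl_apply {v : TwoRebitSpace} (hv : v ∈ tlSubspace Rebit Rebit) :
    ∀ a b c d : Rebit, v.1 (a, b) (c, d) = v.1 (a, d) (c, b) := by
  induction hv using Submodule.span_induction with
  | mem x hx =>
    obtain ⟨α, -, β, hβ, hx⟩ := hx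
    intro a b c d
    have : β b d = β d b := by simpa using (hβ.1.isHermitian.apply b d).symm
    rw [hx]
    simp [Matrix.kroneckerMap_apply, this]
  | zero => simp
  | add x y _ _ hx hy => intro a b c d; simp [hx a b c d, hy a b c d]
  | smul r x _ hx => intro a b c d; simp [hx a b c d]

/-- Conversely, symmetry under transposition of one factor characterizes the span of the product
states. -/
lemma mem_tl {v : TwoRebitSpace}
    (hv : ∀ a b c d : Rebit, v.1 (a, b) (c, d) = v.1 (a, d) (c, b)) :
    v ∈ tlSubspace Rebit Rebit := by
  have sy : ∀ x y, v.1 x y = v.1 y x := fun x y => Matrix.IsSymm.apply v.2 y x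
  have hp : ∀ i j : Fin 3, (probe i ⊗ₖ probe j) ∈ symSpace (Rebit × Rebit) := by
    intro i j
    have h := fun i => (probe_mem_states i).1.isHermitian
    refine Matrix.IsSymm.ext ?_
    rintro ⟨a, b⟩ ⟨c, d⟩
    have h1 : probe i a c = probe i c a := by simpa using ((h i).apply a c).symm
    have h2 : probe j b d = probe j d b := by simpa using ((h j).apply b d).symm
    simp [Matrix.kroneckerMap_apply, h1, h2]
  let w : Fin 3 → Rebit → Rebit → ℝ :=
    ![!![1, -1; 0, 0], !![0, -1; 0, 1], !![0, 2; 0, 0]]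
  have e : v = ∑ i : Fin 3, ∑ j : Fin 3,
      (∑ a, ∑ b, ∑ c, ∑ d, w i a c * w j b d * v.1 (a, b) (c, d)) •
        (⟨probe i ⊗ₖ probe j, hp i j⟩ : TwoRebitSpace) := by
    have s1 := sy (0, 0) (0, 1)
    have s2 := sy (0, 0) (1, 0)
    have s3 := sy (0, 0) (1, 1)
    have s4 := sy (0, 1) (1, 0)
    have s5 := sy (0, 1) (1, 1)
    have s6 := sy (1, 0) (1, 1)
    have t := hv 0 0 1 1
    ext ⟨a, b⟩ ⟨c, d⟩
    fin_cases a <;> fin_cases b <;> fin_cases c <;> fin_cases d <;>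
      simp [Fin.sum_univ_succ, w, probe, Matrix.kroneckerMap_apply] <;> linarith
  rw [e]
  refine Submodule.sum_mem _ fun i _ => Submodule.sum_mem _ fun j _ => Submodule.smul_mem _ _ ?_
  exact Submodule.subset_span ⟨_, probe_mem_states i, _, probe_mem_states j, rfl⟩

/-- Symmetric matrices antisymmetric under transposition of one factor are holistic. -/
lemma mem_holistic {h : TwoRebitSpace}
    (hh : ∀ a b c d : Rebit, h.1 (a, b) (c, d) = - h.1 (a, d) (c, b)) :
    h ∈ holisticSubspace Rebit Rebit := by
  intro e _ f hf
  have hs : f 0 1 = f 1 0 := by simpa using (hf.1.isHermitian.apply 0 1).symm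
  have z : ∀ a b c : Rebit, h.1 (a, b) (c, b) = 0 := fun a b c => by
    have := hh a b c b
    linarith
  have t : ∀ a c : Rebit, h.1 (a, 0) (c, 1) = - h.1 (a, 1) (c, 0) := fun a c => hh a 0 c 1
  simp only [Matrix.trace, Matrix.diag, Matrix.mul_apply, Fintype.sum_prod_type,
    Fin.sum_univ_two, Matrix.kroneckerMap_apply, z, t, hs]
  ring

/-- The space of a pair of rebits is the direct sum of its tomographically local subspace and its
holistic subspace. -/
theorem isCompl_tl_holistic :
    IsCompl (tlSubspace Rebit Rebit) (holisticSubspace Rebit Rebit) := by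
  constructor
  · rw [Submodule.disjoint_def]
    intro x h₁ h₂
    ext ⟨a, b⟩ ⟨c, d⟩
    have e₁ := tl_apply h₁ a b c d
    have e₂ := holistic_apply h₂ a b c d
    simp only [ZeroMemClass.coe_zero, Matrix.zero_apply]
    linarith
  · rw [codisjoint_iff, Submodule.eq_top_iff']
    intro v
    have sy : ∀ x y, v.1 x y = v.1 y x := fun x y => Matrix.IsSymm.apply v.2 y x
    let τ : TwoRebitSpace := ⟨fun x y => v.1 (x.1, y.2) (y.1, x.2), by
      ext x y
      exact sy _ _⟩
    have hτ : ∀ a b c d, τ.1 (a, b) (c, d) = v.1 (a, d) (c, b) := fun _ _ _ _ => rfl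
    refine Submodule.mem_sup.2 ⟨(1 / 2 : ℝ) • (v + τ), mem_tl ?_, (1 / 2 : ℝ) • (v - τ),
      mem_holistic ?_, ?_⟩
    · intro a b c d
      simp [hτ, add_comm]
    · intro a b c d
      simp [hτ]
      ring
    · module

/-- The projection `Π_TL` of the two-rebit space onto its tomographically local subspace along
its holistic subspace. -/
def PiTL : TwoRebitSpace →ₗ[ℝ] TwoRebitSpace :=
  (tlSubspace Rebit Rebit).projection (holisticSubspace Rebit Rebit) isCompl_tl_holistic

/-- A two-rebit state has TL-entanglement when its tomographically local component is not
separable in real quantum theory. -/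
def HasTLEntanglement (ρ : TwoRebitSpace) : Prop :=
  (PiTL ρ : Matrix (Rebit × Rebit) (Rebit × Rebit) ℝ) ∉ separableStates ℝ Rebit Rebit

/-- The natural inclusion of two-rebit vectors into two-qubit matrices, entry by entry. -/
def toQubits (ρ : TwoRebitSpace) : Matrix (Fin 2 × Fin 2) (Fin 2 × Fin 2) ℂ :=
  (ρ : Matrix (Rebit × Rebit) (Rebit × Rebit) ℝ).map Complex.ofReal

end RealQT

end

/-! Partial transposition fixes every product `α ⊗ β` of real states, hence every vector of the
tomographically local subspace. Write such a vector, when it is positive semidefinite on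
`Rebit × n`, as the Gram matrix of vectors `x (a, j)`. Its invariance says that
`x (0, j) ↦ π (x (1, j))`, with `π` the orthogonal projection onto the span of the `x (0, j)`,
defines a symmetric operator on this span. An orthonormal eigenbasis `b i` with eigenvalues `d i`
exhibits the Gram matrix as
`∑ i, (1, d i)(1, d i)ᵀ ⊗ w i (w i)ᵀ + (0, 1)(0, 1)ᵀ ⊗ gram z`,
where `w i j = ⟪b i, x (0, j)⟫` and `z j = x (1, j) - π (x (1, j))`, and this is separable.

If the complexification of `ρ` is `∑ i, p i • (α i ⊗ β i)`, then taking real parts gives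
`ρ = ∑ i, p i • (Re α i ⊗ Re β i) - ∑ i, p i • (Im α i ⊗ Im β i)`. The first sum is a separable
real state, and the second is holistic because symmetric effects annihilate the antisymmetric
matrices `Im α i`. So the first sum is the tomographically local component of `ρ`.
-/

namespace RealQT

open Matrix

section InnerProductSpace

variable {𝕜 E : Type*} [RCLike 𝕜] [NormedAddCommGroup E] [InnerProductSpace 𝕜 E]

theorem inner_eq_inner_starProjection_add_inner_sub (K : Submodule 𝕜 E)
    [K.HasOrthogonalProjection] (u v : E) :
    inner 𝕜 u v = inner 𝕜 (K.starProjection u) (K.starProjection v) +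
      inner 𝕜 (u - K.starProjection u) (v - K.starProjection v) := by
  rw [inner_sub_right _ v, Submodule.starProjection_inner_eq_zero _ _
    (K.starProjection_apply_mem v), sub_zero, inner_sub_left,
    Submodule.inner_starProjection_left_eq_right K u v,
    Submodule.inner_starProjection_left_eq_right K u (K.starProjection v),
    Submodule.starProjection_eq_self_iff.2 (K.starProjection_apply_mem v), add_sub_cancel]

variable {V : Type*} [AddCommGroup V] [Module 𝕜 V]

theorem exists_isSymmetric_apply_eq_starProjection {f g : V →ₗ[𝕜] E}
    [f.range.HasOrthogonalProjection]
    (hfg : ∀ v w, inner 𝕜 (f v) (g w) = inner 𝕜 (g v) (f w)) :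
    ∃ T : E →ₗ[𝕜] E, T.IsSymmetric ∧ ∀ v, T (f v) = f.range.starProjection (g v) := by
  obtain ⟨s, hs⟩ := f.rangeRestrict.exists_rightInverse_of_surjective f.range_rangeRestrict
  have f_s (x : E) : f (s (f.range.orthogonalProjectionOnto x)) = f.range.starProjection x :=
    congrArg Subtype.val (LinearMap.congr_fun hs (f.range.orthogonalProjectionOnto x))
  refine ⟨f.range.starProjection.toLinearMap ∘ₗ g ∘ₗ s ∘ₗ
    f.range.orthogonalProjectionOnto.toLinearMap, fun x y => ?_, fun v => ?_⟩
  · simp only [LinearMap.comp_apply, ContinuousLinearMap.coe_coe]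
    rw [Submodule.inner_starProjection_left_eq_right, ← f_s y, ← hfg, f_s x,
      Submodule.inner_starProjection_left_eq_right]
  · have f_sub : f (s (f.range.orthogonalProjectionOnto (f v)) - v) = 0 := by
      rw [map_sub, f_s, Submodule.starProjection_eq_self_iff.2 (f.mem_range_self v), sub_self]
    simp only [LinearMap.comp_apply, ContinuousLinearMap.coe_coe]
    rw [← sub_eq_zero, ← map_sub, ← map_sub, Submodule.starProjection_apply_eq_zero_iff,
      Submodule.mem_orthogonal']
    rintro _ ⟨w, rfl⟩
    rw [← hfg, f_sub, inner_zero_left]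

variable [FiniteDimensional 𝕜 E]

theorem exists_orthonormalBasis_inner_starProjection_eq_mul {f g : V →ₗ[𝕜] E}
    (hfg : ∀ v w, inner 𝕜 (f v) (g w) = inner 𝕜 (g v) (f w)) :
    ∃ (b : OrthonormalBasis (Fin (Module.finrank 𝕜 E)) 𝕜 E) (d : Fin (Module.finrank 𝕜 E) → ℝ),
      ∀ i v, inner 𝕜 (b i) (f.range.starProjection (g v)) = d i * inner 𝕜 (b i) (f v) := by
  obtain ⟨T, hT, hTf⟩ := exists_isSymmetric_apply_eq_starProjection hfg
  refine ⟨hT.eigenvectorBasis rfl, hT.eigenvalues rfl, fun i v => ?_⟩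
  rw [← hTf, ← hT, hT.apply_eigenvectorBasis, inner_smul_left, RCLike.conj_ofReal]

theorem exists_orthonormalBasis_inner_eq_sum {f g : V →ₗ[𝕜] E}
    (hfg : ∀ v w, inner 𝕜 (f v) (g w) = inner 𝕜 (g v) (f w)) :
    ∃ (b : OrthonormalBasis (Fin (Module.finrank 𝕜 E)) 𝕜 E) (d : Fin (Module.finrank 𝕜 E) → ℝ),
      (∀ v w, inner 𝕜 (g v) (f w) = ∑ i, d i * (inner 𝕜 (f v) (b i) * inner 𝕜 (b i) (f w))) ∧
      ∀ v w, inner 𝕜 (g v) (g w) =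
        ∑ i, d i * d i * (inner 𝕜 (f v) (b i) * inner 𝕜 (b i) (f w)) +
          inner 𝕜 (g v - f.range.starProjection (g v)) (g w - f.range.starProjection (g w)) := by
  obtain ⟨b, d, hbd⟩ := exists_orthonormalBasis_inner_starProjection_eq_mul hfg
  have hdb (v : V) (i) :
      inner 𝕜 (f.range.starProjection (g v)) (b i) = d i * inner 𝕜 (f v) (b i) := by
    rw [← inner_conj_symm, hbd, map_mul, RCLike.conj_ofReal, inner_conj_symm]
  refine ⟨b, d, fun v w => ?_, fun v w => ?_⟩
  · rw [← Submodule.starProjection_eq_self_iff.2 (f.mem_range_self w),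
      ← Submodule.inner_starProjection_left_eq_right, ← b.sum_inner_mul_inner]
    simp only [hdb, Submodule.starProjection_eq_self_iff.2 (f.mem_range_self _), mul_assoc]
  · rw [inner_eq_inner_starProjection_add_inner_sub f.range, ← b.sum_inner_mul_inner]
    simp only [hdb, hbd, mul_mul_mul_comm]

end InnerProductSpace

section Matrix

variable {𝕜 n : Type*} [RCLike 𝕜] [Fintype n]

open scoped MatrixOrder in
theorem exists_eq_gram_of_posSemidef {A : Matrix n n 𝕜} (hA : A.PosSemidef) :
    ∃ x : n → EuclideanSpace 𝕜 n, A = gram 𝕜 x := by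
  classical
  obtain ⟨R, rfl⟩ := CStarAlgebra.nonneg_iff_eq_star_mul_self.1 hA.nonneg
  refine ⟨fun j => WithLp.toLp 2 (R.col j), ?_⟩
  ext i j
  simp [star_eq_conjTranspose, mul_apply, gram_apply, PiLp.inner_apply, mul_comm]

theorem trace_mul_eq_zero_of_isSymm_of_transpose_eq_neg {R : Type*} [CommRing R]
    [IsAddTorsionFree R] {A B : Matrix n n R} (hA : A.IsSymm) (hB : Bᵀ = -B) :
    (A * B).trace = 0 := by
  rw [← self_eq_neg]
  conv_lhs => rw [← trace_transpose, transpose_mul, hA.eq, hB, Matrix.neg_mul, trace_neg,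
    trace_mul_comm B A]

theorem map_re_kronecker {l m p q : Type*} (A : Matrix l m ℂ) (B : Matrix p q ℂ) :
    (A ⊗ₖ B).map Complex.re =
      A.map Complex.re ⊗ₖ B.map Complex.re - A.map Complex.im ⊗ₖ B.map Complex.im := by
  ext
  simp

theorem isSymm_of_posSemidef {n : Type*} {A : Matrix n n ℝ} (hA : A.PosSemidef) : A.IsSymm := by
  rw [IsSymm, ← conjTranspose_eq_transpose_of_trivial, hA.isHermitian.eq]

theorem transpose_map_im_of_isHermitian {n : Type*} {A : Matrix n n ℂ} (hA : A.IsHermitian) :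
    (A.map Complex.im)ᵀ = -A.map Complex.im := by
  ext i j
  simp [← hA.apply j i]

theorem trace_kronecker_mul_kronecker_map_im_eq_zero {m : Type*} [Fintype m]
    {e : Matrix m m ℝ} {α : Matrix m m ℂ} (he : e.IsSymm) (hα : α.IsHermitian)
    (f B : Matrix n n ℝ) :
    ((e ⊗ₖ f) * (α.map Complex.im ⊗ₖ B)).trace = 0 := by
  rw [← mul_kronecker_mul, trace_kronecker, trace_mul_eq_zero_of_isSymm_of_transpose_eq_neg he
    (transpose_map_im_of_isHermitian hα), zero_mul]

end Matrix

section States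

variable {𝕜 m n : Type*} [RCLike 𝕜] [Fintype m] [Fintype n]

theorem exists_mem_states [Nonempty n] : ∃ α, α ∈ states 𝕜 n := by
  classical
  obtain ⟨i⟩ := ‹Nonempty n›
  refine ⟨diagonal (Pi.single i 1), .diagonal (Pi.single_nonneg.2 zero_le_one), ?_⟩
  rw [trace_diagonal, Finset.sum_pi_single']
  simp

theorem exists_eq_smul_mem_states [Nonempty n] {P : Matrix n n 𝕜} (hP : P.PosSemidef) :
    ∃ t : ℝ, 0 ≤ t ∧ ∃ α ∈ states 𝕜 n, P = t • α := by
  obtain ⟨t, ht, htr⟩ := RCLike.nonneg_iff_exists_ofReal.1 hP.trace_nonneg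
  rcases ht.eq_or_lt with rfl | ht_pos
  · obtain ⟨α, hα⟩ := exists_mem_states (𝕜 := 𝕜) (n := n)
    have hP_zero : P = 0 := hP.trace_eq_zero_iff.1 (by rw [← htr, RCLike.ofReal_zero])
    exact ⟨0, le_rfl, α, hα, by rw [hP_zero, zero_smul]⟩
  · refine ⟨t, ht, t⁻¹ • P, ⟨hP.smul (inv_nonneg.2 ht), ?_⟩, (smul_inv_smul₀ ht_pos.ne' P).symm⟩
    rw [trace_smul, ← htr, RCLike.real_smul_ofReal, ← RCLike.ofReal_mul,
      inv_mul_cancel₀ ht_pos.ne', RCLike.ofReal_one]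

open scoped MatrixOrder in
theorem states_subset_effects [DecidableEq n] : states 𝕜 n ⊆ effects 𝕜 n := by
  rintro α ⟨hα, htr⟩
  refine ⟨hα, (CFC.le_one (R := ℝ) (fun x hx => ?_) hα.isHermitian : α ≤ 1)⟩
  rw [hα.isHermitian.spectrum_real_eq_range_eigenvalues] at hx
  obtain ⟨i, rfl⟩ := hx
  have sum_eigenvalues : ∑ j, hα.isHermitian.eigenvalues j = 1 := by
    have h := hα.isHermitian.trace_eq_sum_eigenvalues
    rw [htr] at h
    exact_mod_cast h.symm
  rw [← sum_eigenvalues]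
  exact Finset.single_le_sum (fun j _ => hα.eigenvalues_nonneg j) (Finset.mem_univ i)

theorem map_re_mem_states {α : Matrix n n ℂ} (hα : α ∈ states ℂ n) :
    α.map Complex.re ∈ states ℝ n := by
  refine ⟨.of_dotProduct_mulVec_nonneg ?_ fun x => ?_, ?_⟩
  · ext i j
    simpa using congrArg Complex.re (hα.1.isHermitian.apply i j)
  · have h := (Complex.le_def.1 (hα.1.dotProduct_mulVec_nonneg (fun i => (x i : ℂ)))).1
    simpa [dotProduct, mulVec] using h
  · simpa [trace] using congrArg Complex.re hα.2

theorem kronecker_mem_states {α : Matrix m m 𝕜} {β : Matrix n n 𝕜} (hα : α ∈ states 𝕜 m)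
    (hβ : β ∈ states 𝕜 n) : α ⊗ₖ β ∈ states 𝕜 (m × n) :=
  ⟨hα.1.kronecker hβ.1, by rw [trace_kronecker, hα.2, hβ.2, mul_one]⟩

theorem separableStates_subset_states : separableStates 𝕜 m n ⊆ states 𝕜 (m × n) := by
  rintro _ ⟨k, p, α, β, hp, hsum, hα, hβ, rfl⟩
  have hαβ i := kronecker_mem_states (hα i) (hβ i)
  refine ⟨posSemidef_sum _ fun i _ => (hαβ i).1.smul (hp i), ?_⟩
  simp_rw [trace_sum, trace_smul, (hαβ _).2, ← Finset.sum_smul, hsum, one_smul]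

theorem sum_kronecker_mem_separableStates {ι : Type*} [Fintype ι] {P : ι → Matrix m m 𝕜}
    {Q : ι → Matrix n n 𝕜} (hP : ∀ i, (P i).PosSemidef) (hQ : ∀ i, (Q i).PosSemidef)
    (htr : (∑ i, P i ⊗ₖ Q i).trace = 1) : ∑ i, P i ⊗ₖ Q i ∈ separableStates 𝕜 m n := by
  have : Nonempty (m × n) := by
    by_contra h
    rw [not_nonempty_iff] at h
    simp [trace] at htr
  obtain ⟨_, _⟩ := nonempty_prod.1 this
  choose s hs α hα hPα using fun i => exists_eq_smul_mem_states (hP i)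
  choose t ht β hβ hQβ using fun i => exists_eq_smul_mem_states (hQ i)
  have hPQ i : P i ⊗ₖ Q i = (s i * t i) • (α i ⊗ₖ β i) := by
    rw [hPα, hQβ, smul_kronecker, kronecker_smul, smul_smul]
  simp_rw [hPQ] at htr ⊢
  have sum_weights : ∑ i, s i * t i = 1 := by
    simp_rw [trace_sum, trace_smul, (kronecker_mem_states (hα _) (hβ _)).2,
      ← Finset.sum_smul, RCLike.real_smul_eq_coe_mul, mul_one] at htr
    exact_mod_cast htr
  let e := (Fintype.equivFin ι).symm
  refine ⟨Fintype.card ι, fun i => s (e i) * t (e i), α ∘ e, β ∘ e,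
    fun i => mul_nonneg (hs _) (ht _), ?_, fun i => hα _, fun i => hβ _, ?_⟩
  · rw [← sum_weights]
    exact e.sum_comp fun i => s i * t i
  · exact (e.sum_comp fun i => (s i * t i) • (α i ⊗ₖ β i)).symm

end States

section PartialTranspose

/-- The partial transpose of a matrix on a bipartite system: the transposition of the second
factor. A real state of `Rebit × n` is separable exactly when it is fixed by it. -/
def partialTranspose {R m n : Type*} (M : Matrix (m × n) (m × n) R) : Matrix (m × n) (m × n) R :=
  of fun x y => M (x.1, y.2) (y.1, x.2)

theorem partialTranspose_kronecker {R m n : Type*} [Mul R] (A : Matrix m m R) (B : Matrix n n R) :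
    partialTranspose (A ⊗ₖ B) = A ⊗ₖ Bᵀ :=
  rfl

variable {n : Type*}

theorem exists_gram_eq_sum_kronecker {E : Type*} [NormedAddCommGroup E]
    [InnerProductSpace ℝ E] [FiniteDimensional ℝ E] {x : Rebit × n → E}
    (hx : partialTranspose (gram ℝ x) = gram ℝ x) :
    ∃ (d : Fin (Module.finrank ℝ E) → ℝ) (w : Fin (Module.finrank ℝ E) → n → ℝ) (z : n → E),
      gram ℝ x = ∑ i, vecMulVec ![1, d i] ![1, d i] ⊗ₖ vecMulVec (w i) (w i) +
        vecMulVec ![0, 1] ![0, 1] ⊗ₖ gram ℝ z := by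
  let f (a : Rebit) : (n →₀ ℝ) →ₗ[ℝ] E := Finsupp.linearCombination ℝ fun j => x (a, j)
  have f_single (a : Rebit) (j : n) : f a (Finsupp.single j 1) = x (a, j) := by
    simp [f]
  have inner_swap (j k : n) : inner ℝ (x (0, j)) (x (1, k)) = inner ℝ (x (1, j)) (x (0, k)) := by
    rw [real_inner_comm (x (0, k))]
    exact (congrFun₂ hx (0, j) (1, k)).symm
  have hf (v w : n →₀ ℝ) : inner ℝ (f 0 v) (f 1 w) = inner ℝ (f 1 v) (f 0 w) := by
    simp only [f, Finsupp.linearCombination_apply, Finsupp.sum, sum_inner, inner_sum,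
      real_inner_smul_left, real_inner_smul_right, inner_swap]
  obtain ⟨b, d, inner_gf, inner_gg⟩ := exists_orthonormalBasis_inner_eq_sum hf
  have inner_00 (j k : n) : inner ℝ (x (0, j)) (x (0, k)) =
      ∑ i, inner ℝ (x (0, j)) (b i) * inner ℝ (b i) (x (0, k)) :=
    (b.sum_inner_mul_inner _ _).symm
  have inner_10 (j k : n) : inner ℝ (x (1, j)) (x (0, k)) =
      ∑ i, d i * (inner ℝ (x (0, j)) (b i) * inner ℝ (b i) (x (0, k))) := by
    simpa only [f_single, RCLike.ofReal_real_eq_id, id] using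
      inner_gf (Finsupp.single j 1) (Finsupp.single k 1)
  let z (j : n) : E := x (1, j) - (f 0).range.starProjection (x (1, j))
  have inner_11 (j k : n) : inner ℝ (x (1, j)) (x (1, k)) =
      ∑ i, d i * d i * (inner ℝ (x (0, j)) (b i) * inner ℝ (b i) (x (0, k))) +
        inner ℝ (z j) (z k) := by
    simpa only [f_single, RCLike.ofReal_real_eq_id, id] using
      inner_gg (Finsupp.single j 1) (Finsupp.single k 1)
  refine ⟨d, fun i j => inner ℝ (b i) (x (0, j)), z, ?_⟩
  ext ⟨a, j⟩ ⟨c, k⟩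
  fin_cases a <;> fin_cases c <;>
    simp [Matrix.sum_apply, vecMulVec_apply, gram_apply, inner_swap, inner_00, inner_10, inner_11,
      real_inner_comm (b _)]

theorem mem_separableStates_of_partialTranspose_eq [Fintype n]
    {M : Matrix (Rebit × n) (Rebit × n) ℝ}
    (hM : M ∈ states ℝ (Rebit × n)) (hpt : partialTranspose M = M) :
    M ∈ separableStates ℝ Rebit n := by
  obtain ⟨hpsd, htr⟩ := hM
  obtain ⟨x, rfl⟩ := exists_eq_gram_of_posSemidef hpsd
  obtain ⟨d, w, z, hdec⟩ := exists_gram_eq_sum_kronecker hpt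
  let P : Option _ → Matrix Rebit Rebit ℝ :=
    Option.rec (vecMulVec ![0, 1] ![0, 1]) fun i => vecMulVec ![1, d i] ![1, d i]
  let Q : Option _ → Matrix n n ℝ := Option.rec (gram ℝ z) fun i => vecMulVec (w i) (w i)
  have hsum : gram ℝ x = ∑ i, P i ⊗ₖ Q i := by
    rw [hdec, Fintype.sum_option, add_comm]
  rw [hsum] at htr ⊢
  refine sum_kronecker_mem_separableStates ?_ ?_ htr
  · rintro (_ | i)
    exacts [posSemidef_vecMulVec_self_star _, posSemidef_vecMulVec_self_star _]
  · rintro (_ | i)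
    exacts [posSemidef_gram ℝ z, posSemidef_vecMulVec_self_star _]

end PartialTranspose

section TLComponent

variable {m n : Type*} [Fintype m] [Fintype n]

theorem partialTranspose_eq_of_mem_tlSubspace {v : symSpace (m × n)} (hv : v ∈ tlSubspace m n) :
    partialTranspose (v : Matrix (m × n) (m × n) ℝ) = v := by
  induction hv using Submodule.span_induction with
  | mem v hv =>
    obtain ⟨α, -, β, hβ, hv⟩ := hv
    rw [hv, partialTranspose_kronecker, (isSymm_of_posSemidef hβ.1).eq]
  | zero => rfl
  | add u v _ _ hu hv => exact congrArg₂ (· + ·) hu hv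
  | smul c v _ hv => exact congrArg (c • ·) hv

theorem mem_tlSubspace_of_mem_separableStates {v : symSpace (m × n)}
    (hv : (v : Matrix (m × n) (m × n) ℝ) ∈ separableStates ℝ m n) : v ∈ tlSubspace m n := by
  obtain ⟨k, p, α, β, -, -, hα, hβ, hv⟩ := hv
  let u (i : Fin k) : symSpace (m × n) :=
    ⟨α i ⊗ₖ β i, isSymm_of_posSemidef (kronecker_mem_states (hα i) (hβ i)).1⟩
  have v_eq : v = ∑ i, p i • u i := by
    ext1
    simp [hv, u]
  rw [v_eq]
  exact Submodule.sum_mem _ fun i _ => Submodule.smul_mem _ _ <|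
    Submodule.subset_span ⟨α i, hα i, β i, hβ i, rfl⟩

variable [DecidableEq m] [DecidableEq n]

theorem trace_mul_eq_zero_of_mem_tlSubspace_of_mem_holisticSubspace {v h : symSpace (m × n)}
    (hv : v ∈ tlSubspace m n) (hh : h ∈ holisticSubspace m n) :
    ((v : Matrix (m × n) (m × n) ℝ) * h).trace = 0 := by
  induction hv using Submodule.span_induction with
  | mem v hv =>
    obtain ⟨α, hα, β, hβ, hv⟩ := hv
    rw [hv]
    exact hh α (states_subset_effects hα) β (states_subset_effects hβ)
  | zero => simp
  | add u v _ _ hu hv => simp [Matrix.add_mul, hu, hv]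
  | smul c v _ hv => simp [hv]

theorem disjoint_tlSubspace_holisticSubspace :
    Disjoint (tlSubspace m n) (holisticSubspace m n) := by
  refine Submodule.disjoint_def.2 fun v hv hv' => Subtype.ext ?_
  have h := trace_mul_eq_zero_of_mem_tlSubspace_of_mem_holisticSubspace hv hv'
  rwa [ZeroMemClass.coe_zero, ← trace_conjTranspose_mul_self_eq_zero_iff,
    conjTranspose_eq_transpose_of_trivial, v.2.eq]

/-- `v` is the tomographically local component of `ρ` in a decomposition of `ρ` along the
tomographically local and the holistic subspaces. For a pair of rebits `PiTL ρ` is the only such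
vector; the relation makes sense for all systems, whether or not the two subspaces span. -/
def IsTLComponent (v ρ : symSpace (m × n)) : Prop :=
  v ∈ tlSubspace m n ∧ ρ - v ∈ holisticSubspace m n

theorem IsTLComponent.unique {u v ρ : symSpace (m × n)} (hu : IsTLComponent u ρ)
    (hv : IsTLComponent v ρ) : u = v := by
  refine sub_eq_zero.1 (Submodule.disjoint_def.1 disjoint_tlSubspace_holisticSubspace _
    (sub_mem hu.1 hv.1) ?_)
  rw [← sub_sub_sub_cancel_left v u ρ]
  exact sub_mem hv.2 hu.2

theorem isTLComponent_PiTL (ρ : TwoRebitSpace) : IsTLComponent (PiTL ρ) ρ := by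
  have hmem : PiTL ρ ∈ tlSubspace Rebit Rebit :=
    Submodule.projection_apply_mem isCompl_tl_holistic ρ
  refine ⟨hmem, (Submodule.projection_apply_eq_zero_iff isCompl_tl_holistic).1 ?_⟩
  rw [map_sub, sub_eq_zero]
  exact (Submodule.projection_apply_of_mem_left isCompl_tl_holistic hmem).symm

theorem IsTLComponent.mem_separableStates {v ρ : symSpace (m × n)} (hv : IsTLComponent v ρ)
    (hρ : (ρ : Matrix (m × n) (m × n) ℝ).map Complex.ofReal ∈ separableStates ℂ m n) :
    (v : Matrix (m × n) (m × n) ℝ) ∈ separableStates ℝ m n := by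
  obtain ⟨k, p, α, β, hp, hsum, hα, hβ, hρ⟩ := hρ
  let σ : Matrix (m × n) (m × n) ℝ :=
    ∑ i, p i • ((α i).map Complex.re ⊗ₖ (β i).map Complex.re)
  have hσ : σ ∈ separableStates ℝ m n :=
    ⟨k, p, _, _, hp, hsum, fun i => map_re_mem_states (hα i), fun i => map_re_mem_states (hβ i),
      rfl⟩
  have sub_eq : (ρ : Matrix (m × n) (m × n) ℝ) - σ =
      -∑ i, p i • ((α i).map Complex.im ⊗ₖ (β i).map Complex.im) := by
    have h : (ρ : Matrix (m × n) (m × n) ℝ) = ∑ i, p i • (α i ⊗ₖ β i).map Complex.re := by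
      ext x y
      simpa [Matrix.sum_apply] using congrArg Complex.re (congrFun₂ hρ x y)
    simp only [h, map_re_kronecker, smul_sub, Finset.sum_sub_distrib, σ, sub_sub_cancel_left]
  let w : symSpace (m × n) := ⟨σ, isSymm_of_posSemidef (separableStates_subset_states hσ).1⟩
  have hw : IsTLComponent w ρ := by
    refine ⟨mem_tlSubspace_of_mem_separableStates hσ, fun e he f _ => ?_⟩
    have he_symm := isSymm_of_posSemidef he.1
    simp [w, sub_eq, Matrix.mul_sum, trace_sum,
      trace_kronecker_mul_kronecker_map_im_eq_zero he_symm (hα _).1.isHermitian]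
  rwa [hv.unique hw]

theorem IsTLComponent.mem_separableStates_iff_mem_states {v ρ : symSpace (Rebit × n)}
    (hv : IsTLComponent v ρ) :
    (v : Matrix (Rebit × n) (Rebit × n) ℝ) ∈ separableStates ℝ Rebit n ↔
      (v : Matrix (Rebit × n) (Rebit × n) ℝ) ∈ states ℝ (Rebit × n) :=
  ⟨fun h => separableStates_subset_states h, fun h =>
    mem_separableStates_of_partialTranspose_eq h (partialTranspose_eq_of_mem_tlSubspace hv.1)⟩

end TLComponent

end RealQT

theorem proposition7_general {n : Type*} [Fintype n] [DecidableEq n]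
    {v ρ : RealQT.symSpace (RealQT.Rebit × n)} (hv : RealQT.IsTLComponent v ρ) :
    ((v : Matrix (RealQT.Rebit × n) (RealQT.Rebit × n) ℝ) ∈
        RealQT.separableStates ℝ RealQT.Rebit n ↔
      (v : Matrix (RealQT.Rebit × n) (RealQT.Rebit × n) ℝ) ∈ RealQT.states ℝ (RealQT.Rebit × n)) ∧
    ((ρ : Matrix (RealQT.Rebit × n) (RealQT.Rebit × n) ℝ).map Complex.ofReal ∈
        RealQT.separableStates ℂ RealQT.Rebit n →
      (v : Matrix (RealQT.Rebit × n) (RealQT.Rebit × n) ℝ) ∈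
        RealQT.separableStates ℝ RealQT.Rebit n) :=
  ⟨hv.mem_separableStates_iff_mem_states, hv.mem_separableStates⟩

theorem proposition7 (ρ : RealQT.TwoRebitSpace)
    (hρ : (ρ : Matrix (RealQT.Rebit × RealQT.Rebit) (RealQT.Rebit × RealQT.Rebit) ℝ) ∈
      RealQT.states ℝ (RealQT.Rebit × RealQT.Rebit)) :
    (¬ RealQT.HasTLEntanglement ρ ↔
      (RealQT.PiTL ρ : Matrix (RealQT.Rebit × RealQT.Rebit) (RealQT.Rebit × RealQT.Rebit) ℝ) ∈
        RealQT.states ℝ (RealQT.Rebit × RealQT.Rebit)) ∧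
    (RealQT.toQubits ρ ∈ RealQT.separableStates ℂ (Fin 2) (Fin 2) →
      ¬ RealQT.HasTLEntanglement ρ) := by
  simp only [RealQT.HasTLEntanglement, not_not]
  exact proposition7_general (RealQT.isTLComponent_PiTL ρ)
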